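/- For a subset $X$ of a metric space $M$ and $r\ge 0$ let $X^r=\{p\in M : \exists x\in X,\ d(x,p)\le r\}$. For $X\subseteq\mathbb{R}^d$ (Euclidean metric) let $\operatorname{Unp}(X)$ be the set of points of $\mathbb{R}^d$ with a unique nearest point in $X$, and let the reach of $X$ be $\tau(X)=\sup\{r\ge 0 : X^r\subseteq \operatorname{Unp}(X)\}\in[0,\infty]$. For a continuous function $f:X\to\mathbb{R}$ on a topological space, the Reeb graph $\operatorname{Rb}(X,f)$ is the quotient space of $X$ that identifies $x$ and $y$ whenever they lie in the same connected component of the same level set of $f$, together with the induced continuous function $\tilde f:\operatorname{Rb}(X,f)\to\mathbb{R}$. Let $\mathbf{Int}$ be the category of nonempty open intervals of $\mathbb{R}$ (bounded or not) with inclusions as morphisms, and for $\delta\ge0$ let $\omega_\delta:\mathbf{Int}\to\mathbf{Int}$ be the widening functor $I\mapsto I^\delta$, i.e. $(a,b)\mapsto(a-\delta,b+\delta)$. For a space $Y$ with a continuous function $g:Y\to\mathbb{R}$, let $\mathcal{D}(Y,g):\mathbf{Int}\to\mathbf{Set}$ be the functor sending $I$ to the set of connected components of $g^{-1}(I)$.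 Functors $C,D:\mathbf{Int}\to\mathbf{Set}$ are $\delta$-interleaved if there are natural transformations $\Phi:C\to D\circ\omega_\delta$ and $\Psi:D\to C\circ\omega_\delta$ with $\Psi_{\omega_\delta(I)}\circ\Phi_I=C(I\subseteq\omega_{2\delta}(I))$ and $\Phi_{\omega_\delta(I)}\circ\Psi_I=D(I\subseteq\omega_{2\delta}(I))$ for all $I$. The interleaving distance $d_{\mathrm I}((X,f),(Y,g))\in[0,\infty]$ is the infimum of all $\delta\ge0$ such that $\mathcal{D}(X,f)$ and $\mathcal{D}(Y,g)$ are $\delta$-interleaved. **Corollary.** Let $X\subseteq\mathbb{R}^d$ be a closed subset with positive reach. Let $0\le\delta<\beta<\tau(X)$, $\alpha>0$, $k>0$, suppose that $(\beta-\delta)^2-(\beta-\alpha)^2\ge 0$, and let $$0\le\varepsilon\le\sqrt{(\beta-\delta)^2-(\beta-\alpha)^2}.$$ If $A\subseteq X^\delta$, $X^\alpha\subseteq A^\varepsilon$ and $g:A^\varepsilon\to\mathbb{R}$ is $k$-Lipschitz, then (noting that $X\subseteq X^\alpha\subseteq A^\varepsilon$) $$d_{\mathrm I}\bigl(\operatorname{Rb}(A^\varepsilon,g),\operatorname{Rb}(X,g|_X)\bigr)\le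 k(\varepsilon+\delta).$$ -/

import Mathlib

open CategoryTheory
open scoped ENNReal NNReal Pointwise

universe u v w

namespace ReebApprox

noncomputable section

/-! ### Thickenings and reach -/

/-- The `r`-thickening `X^r`: the union of the closed balls of radius `r` centred at points
of `X`. -/
def thick {M : Type u} [MetricSpace M] (r : ℝ) (X : Set M) : Set M :=
  {p | ∃ x ∈ X, dist x p ≤ r}

theorem subset_thick {M : Type u} [MetricSpace M] {r : ℝ} (hr : 0 ≤ r) (X : Set M) :
    X ⊆ thick r X :=
  fun x hx => ⟨x, hx, by simpa using hr⟩

/-- The set of points with a unique nearest point in `X`. -/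
def Unp {M : Type u} [MetricSpace M] (X : Set M) : Set M :=
  {p | ∃ x ∈ X, ∀ x' ∈ X \ {x}, dist x p < dist x' p}

/-- The reach `τ(X)`, the supremum in `[0, ∞]` of all `r ≥ 0` such that `X^r ⊆ Unp(X)`. -/
def reach {M : Type u} [MetricSpace M] (X : Set M) : ℝ≥0∞ :=
  ⨆ (r : ℝ≥0) (_ : thick (r : ℝ) X ⊆ Unp X), (r : ℝ≥0∞)

/-! ### Reeb graphs -/

/-- Two points are identified when they lie in the same connected component of the same level
set of `f`. -/
def reebSetoid {X : Type u} [TopologicalSpace X] (f : C(X, ℝ)) : Setoid X where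
  r x y := y ∈ connectedComponentIn (f ⁻¹' {f x}) x
  iseqv := by
    have key : ∀ {x y : X}, y ∈ connectedComponentIn (f ⁻¹' {f x}) x →
        connectedComponentIn (f ⁻¹' {f y}) y = connectedComponentIn (f ⁻¹' {f x}) x := by
      intro x y h
      have hy : f y = f x := connectedComponentIn_subset (f ⁻¹' {f x}) x h
      rw [hy]
      exact (connectedComponentIn_eq h).symm
    refine ⟨fun x => mem_connectedComponentIn rfl, fun {x y} h => ?_, fun {x y z} h h' => ?_⟩
    · rw [key h]
      exact mem_connectedComponentIn rfl
    · rwa [key h] at h'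

/-- The underlying space of the Reeb graph, with the quotient topology. -/
def Rb {X : Type u} [TopologicalSpace X] (f : C(X, ℝ)) : Type u :=
  Quotient (reebSetoid f)

instance {X : Type u} [TopologicalSpace X] (f : C(X, ℝ)) : TopologicalSpace (Rb f) :=
  inferInstanceAs (TopologicalSpace (Quotient (reebSetoid f)))

/-- The continuous function on the Reeb graph induced by `f`, sending `[x]` to `f x`. -/
def rbMap {X : Type u} [TopologicalSpace X] (f : C(X, ℝ)) : C(Rb f, ℝ) where
  toFun := Quotient.lift f fun x y h => by
    have hy : y ∈ f ⁻¹' {f x} := connectedComponentIn_subset _ _ h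
    exact (Set.mem_singleton_iff.1 hy).symm
  continuous_toFun := f.continuous.quotient_lift _

/-! ### Interleavings of functors on open intervals -/

/-- The (nonempty) open intervals of `ℝ`, bounded or not, ordered by inclusion. As a preorder it
is regarded as a category, with the inclusions as morphisms. -/
abbrev Interval : Type :=
  {I : Set ℝ // IsOpen I ∧ I.OrdConnected ∧ I.Nonempty}

theorem thick_eq_add (δ : ℝ) (I : Set ℝ) : thick δ I = I + Metric.closedBall (0 : ℝ) δ := by
  ext p
  constructor
  · rintro ⟨x, hx, h⟩
    refine ⟨x, hx, p - x, ?_, by ring⟩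
    rw [mem_closedBall_zero_iff, Real.norm_eq_abs, abs_sub_comm]
    simpa [Real.dist_eq] using h
  · rintro ⟨x, hx, z, hz, rfl⟩
    refine ⟨x, hx, ?_⟩
    rw [mem_closedBall_zero_iff] at hz
    simpa [Real.dist_eq] using hz

theorem thick_interval {I : Set ℝ} (δ : ℝ≥0)
    (hI : IsOpen I ∧ I.OrdConnected ∧ I.Nonempty) :
    IsOpen (thick (δ : ℝ) I) ∧ (thick (δ : ℝ) I).OrdConnected ∧ (thick (δ : ℝ) I).Nonempty := by
  obtain ⟨ho, hc, hn⟩ := hI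
  refine ⟨?_, ?_, hn.mono (subset_thick δ.2 I)⟩
  · rw [thick_eq_add]
    exact ho.add_right
  · rw [thick_eq_add, ← convex_iff_ordConnected]
    exact (convex_iff_ordConnected.2 hc).add (convex_closedBall _ _)

/-- The widening functor `ω_δ`, sending an open interval to its `δ`-thickening; for a bounded
interval, `(a, b) ↦ (a - δ, b + δ)`. -/
def widen (δ : ℝ≥0) : Interval ⥤ Interval :=
  Monotone.functor (f := fun I => ⟨thick (δ : ℝ) I.1, thick_interval δ I.2⟩)
    fun _ _ hIJ _ ⟨x, hx, h⟩ => ⟨x, hIJ hx, h⟩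

theorem le_widen_widen (δ : ℝ≥0) (I : Interval) :
    I ≤ (widen δ).obj ((widen δ).obj I) :=
  fun _ hx => subset_thick δ.2 _ (subset_thick δ.2 _ hx)

/-- `C` and `D` are `δ`-interleaved. The morphism `C.map (homOfLE _)` is
`C(I ⊆ ω_{2δ}(I))`, where `ω_{2δ}(I) = ω_δ(ω_δ(I))`. -/
def Interleaved {A : Type v} [Category.{w} A] (δ : ℝ≥0) (C D : Interval ⥤ A) : Prop :=
  ∃ (Φ : C ⟶ widen δ ⋙ D) (Ψ : D ⟶ widen δ ⋙ C), ∀ I : Interval,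
    Φ.app I ≫ Ψ.app ((widen δ).obj I) = C.map (homOfLE (le_widen_widen δ I)) ∧
    Ψ.app I ≫ Φ.app ((widen δ).obj I) = D.map (homOfLE (le_widen_widen δ I))

/-- The interleaving distance, with values in `[0, ∞]` (and `∞` if there is no interleaving). -/
def functorDist {A : Type v} [Category.{w} A] (C D : Interval ⥤ A) : ℝ≥0∞ :=
  ⨅ (δ : ℝ≥0) (_ : Interleaved δ C D), (δ : ℝ≥0∞)

/-! ### The Reeb precosheaf -/

/-- The functor sending a space to its set of connected components. -/
def C₀ : TopCat.{u} ⥤ Type u where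
  obj X := ConnectedComponents X
  map g := TypeCat.ofHom g.hom.continuous.connectedComponentsMap
  map_id X := by
    ext x
    obtain ⟨x, rfl⟩ := ConnectedComponents.surjective_coe x
    rfl
  map_comp g h := by
    ext x
    obtain ⟨x, rfl⟩ := ConnectedComponents.surjective_coe x
    rfl

/-- The preimage functor, sending `I` to the subspace `f⁻¹(I)` and inclusions to inclusions. -/
def Pre {X : Type u} [TopologicalSpace X] (f : C(X, ℝ)) : Interval ⥤ TopCat.{u} where
  obj I := TopCat.of (f ⁻¹' I.1)
  map {I J} i := TopCat.ofHom
    ⟨Set.inclusion (Set.preimage_mono (leOfHom i : I.1 ⊆ J.1)), continuous_inclusion _⟩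

/-- The Reeb precosheaf, sending `I` to the set of connected components of `f⁻¹(I)`. -/
def precosheaf {X : Type u} [TopologicalSpace X] (f : C(X, ℝ)) : Interval ⥤ Type u :=
  Pre f ⋙ C₀

/-- The interleaving distance between the `ℝ`-spaces `(X, f)` and `(Y, g)`. -/
def dI {X Y : Type u} [TopologicalSpace X] [TopologicalSpace Y] (f : C(X, ℝ)) (g : C(Y, ℝ)) :
    ℝ≥0∞ :=
  functorDist (precosheaf f) (precosheaf g)

/-- The restriction of a continuous function `g : Y → ℝ` to a subset `X ⊆ Y`. -/
def restrictTo {M : Type u} [TopologicalSpace M] {X Y : Set M} (h : X ⊆ Y) (g : C(Y, ℝ)) :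
    C(X, ℝ) :=
  g.comp ⟨Set.inclusion h, continuous_inclusion h⟩

end

end ReebApprox

open ReebApprox

namespace ReebApprox

/-! Every point of `A^ε` lies within `ε + δ ≤ β` of `X`, hence has a unique nearest point, and the
nearest-point projection `π : A^ε → X` is continuous and fixes `X`. If each segment from `y` to `π
y` stays in `A^ε`, then inclusion and projection interleave the two precosheaves: points move at
most `ε + δ`, so `g` changes by at most `k(ε + δ)` (`interleaved_of_retraction`). Reeb graphs have
the same precosheaves as the original spaces (`precosheafRbIso`).

The crux is `segment_subset_thick`. Up to distance `α` from `π y` the segment lies in `X^α ⊆ A^ε`.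
Beyond that, the point `a ∈ A` with `dist a y ≤ ε` covers the rest: by Federer's tangent ball
property (`le_dist_tangent_center`) `a` is at least `β - δ` from the centre at distance `β` along
the ray, and the bound on `ε` then keeps the segment within `ε` of `a`. The tangent ball comes from
pushing a point away from `X` at unit speed (`exists_infDist_add_le`). -/

/-! ### Reach and stability of unique nearest points. -/

theorem exists_thick_subset_Unp {M : Type*} [MetricSpace M] {X : Set M} {β : ℝ}
    (h : ENNReal.ofReal β < reach X) : ∃ r : ℝ, β ≤ r ∧ thick r X ⊆ Unp X := by
  obtain ⟨r, hr⟩ := lt_iSup_iff.1 h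
  obtain ⟨hr, hlt⟩ := lt_iSup_iff.1 hr
  refine ⟨r, ?_, hr⟩
  rw [ENNReal.ofReal, ENNReal.coe_lt_coe] at hlt
  exact (Real.le_coe_toNNReal β).trans (NNReal.coe_le_coe.2 hlt.le)

theorem thick_mono {M : Type*} [MetricSpace M] {X : Set M} {r s : ℝ} (h : r ≤ s) :
    thick r X ⊆ thick s X :=
  fun _ ⟨x, hx, hp⟩ => ⟨x, hx, hp.trans h⟩

theorem infDist_eq_dist_of_forall_le {M : Type*} [MetricSpace M] {X : Set M} {x p : M}
    (hx : x ∈ X) (h : ∀ z ∈ X, dist x p ≤ dist z p) : Metric.infDist p X = dist x p := by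
  apply le_antisymm
  · rw [dist_comm]
    exact Metric.infDist_le_dist_of_mem hx
  · rw [Metric.le_infDist ⟨x, hx⟩]
    intro z hz
    rw [dist_comm p z]
    exact h z hz

/-- Nearest points depend continuously on the point, wherever they are unique. -/
theorem exists_dist_nearest_lt {M : Type*} [MetricSpace M] [ProperSpace M] {X : Set M}
    (hX : IsClosed X) {x w : M} (hx : x ∈ X) (hu : ∀ z ∈ X \ {x}, dist x w < dist z w)
    {η : ℝ} (hη : 0 < η) :
    ∃ ρ > 0, ∀ w', dist w' w < ρ → ∀ x' ∈ X, dist x' w' ≤ dist x w' → dist x' x < η := by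
  -- `K` holds the competitors of `x` at distance at least `η`. By compactness their distance to `w`
  -- exceeds `dist x w` by a positive gap, and half of that gap bounds the allowed perturbation. The
  -- radius `dist x w + 1` matches `ρ ≤ 1 / 2`.
  set K : Set M := (X ∩ Metric.closedBall w (dist x w + 1)) \ Metric.ball x η with hK
  have hKc : IsCompact K :=
    ((isCompact_closedBall w _).inter_left hX).diff Metric.isOpen_ball
  have key : ∀ {ρ : ℝ} {w' x' : M}, dist w' w < ρ → dist x' w' ≤ dist x w' →
      dist x' w < dist x w + 2 * ρ := by
    intro ρ w' x' h1 h2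
    have h3 := dist_triangle x' w' w
    have h4 := dist_triangle x w w'
    rw [dist_comm w w'] at h4
    linarith
  rcases K.eq_empty_or_nonempty with hE | hN
  · refine ⟨1 / 2, by norm_num, fun w' hw' x' hx' hle => ?_⟩
    by_contra hlt
    have : x' ∈ K := ⟨⟨hx', by
      rw [Metric.mem_closedBall]
      linarith [key hw' hle]⟩, hlt⟩
    simp [hE] at this
  · obtain ⟨z, hz, hmin⟩ := hKc.exists_isMinOn hN
      (f := fun z => dist z w) (by fun_prop)
    have hzx : z ≠ x := by
      rintro rfl
      exact hz.2 (Metric.mem_ball_self hη)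
    have hm := hu z ⟨hz.1.1, hzx⟩
    refine ⟨min (1 / 2) ((dist z w - dist x w) / 2), lt_min (by norm_num) (by linarith),
      fun w' hw' x' hx' hle => ?_⟩
    by_contra hlt
    have h1 := key (hw'.trans_le (min_le_left _ _)) hle
    have h2 := key (hw'.trans_le (min_le_right _ _)) hle
    have : x' ∈ K := ⟨⟨hx', by
      rw [Metric.mem_closedBall]
      linarith⟩, hlt⟩
    have h3 : dist z w ≤ dist x' w := hmin this
    linarith

/-! ### Growth of the distance function, tangent balls and segments. -/

section InnerProduct

variable {E : Type*} [NormedAddCommGroup E] [InnerProductSpace ℝ E]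

/-- Near a point with a unique nearest point, the distance to `X` has ascent rate at least `c`
for every `c < 1`. -/
theorem exists_infDist_ascent [ProperSpace E] {X : Set E} (hX : IsClosed X) {w : E} (hw : w ∈ Unp X)
    (hpos : 0 < Metric.infDist w X) {c : ℝ} (hc0 : 0 ≤ c) (hc1 : c < 1) {ρ : ℝ} (hρ : 0 < ρ) :
    ∃ w', dist w' w < ρ ∧ Metric.infDist w X + c * dist w' w < Metric.infDist w' X := by
  obtain ⟨x, hx, hu⟩ := hw
  have hle : ∀ z ∈ X, dist x w ≤ dist z w := by
    intro z hz
    rcases eq_or_ne z x with rfl | hne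
    · exact le_rfl
    · exact (hu z ⟨hz, hne⟩).le
  have hD := infDist_eq_dist_of_forall_le hx hle
  rw [hD] at hpos ⊢
  set D := dist x w with hDdef
  -- Move `w` by `h` along the unit vector `n` pointing away from `x`. The new nearest point `x'` is
  -- within `(1 - c) * D` of `x`, so `⟪w - x', n⟫ ≥ c * D`, and the new squared distance is at least
  -- `D² + 2chD + h² > (D + ch)²`.
  obtain ⟨ρ', hρ', hnear⟩ := exists_dist_nearest_lt hX hx hu
    (η := (1 - c) * D) (mul_pos (by linarith) hpos)
  set h := min ρ ρ' / 2 with hh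
  have hh0 : 0 < h := half_pos (lt_min hρ hρ')
  have hhlt : h < min ρ ρ' := half_lt_self (lt_min hρ hρ')
  have hDn : ‖w - x‖ = D := by rw [hDdef, dist_comm, dist_eq_norm]
  set n : E := D⁻¹ • (w - x) with hn
  have hn1 : ‖n‖ = 1 := by
    rw [hn, norm_smul, hDn, norm_inv, Real.norm_of_nonneg hpos.le, inv_mul_cancel₀ hpos.ne']
  have hww : dist (w + h • n) w = h := by
    rw [dist_eq_norm, add_sub_cancel_left, norm_smul, hn1, mul_one, Real.norm_of_nonneg hh0.le]
  refine ⟨w + h • n, by rw [hww]; exact hhlt.trans_le (min_le_left _ _), ?_⟩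
  rw [hww]
  obtain ⟨x', hx', hd'⟩ := hX.exists_infDist_eq_dist ⟨x, hx⟩ (w + h • n)
  have hx'x : dist x' x < (1 - c) * D := by
    refine hnear (w + h • n) (by rw [hww]; exact hhlt.trans_le (min_le_right _ _)) x' hx' ?_
    rw [dist_comm x', ← hd', dist_comm x]
    exact Metric.infDist_le_dist_of_mem hx
  rw [hd']
  refine lt_of_pow_lt_pow_left₀ 2 dist_nonneg ?_
  have e1 : dist (w + h • n) x' ^ 2 = ‖w - x'‖ ^ 2 + 2 * (h * inner ℝ (w - x') n) + h ^ 2 := by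
    rw [dist_eq_norm, add_sub_right_comm, norm_add_sq_real, inner_smul_right, norm_smul, hn1,
      mul_one, Real.norm_of_nonneg hh0.le]
  have e2 : D ≤ ‖w - x'‖ := by
    rw [← dist_eq_norm, dist_comm]
    exact hle x' hx'
  have e3 : c * D ≤ inner ℝ (w - x') n := by
    have h1 : inner ℝ (w - x) n = D := by
      rw [hn, inner_smul_right, real_inner_self_eq_norm_sq, hDn]
      field_simp
    have h2 : inner ℝ (x' - x) n ≤ (1 - c) * D := by
      refine (real_inner_le_norm _ _).trans ?_
      rw [hn1, mul_one, ← dist_eq_norm]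
      exact hx'x.le
    have h3 : w - x' = (w - x) - (x' - x) := by abel
    rw [h3, inner_sub_left, h1]
    linarith
  rw [e1]
  have e4 : D ^ 2 ≤ ‖w - x'‖ ^ 2 := pow_le_pow_left₀ hpos.le e2 2
  have e5 := mul_le_mul_of_nonneg_left e3 hh0.le
  have e6 : (c * h) ^ 2 < h ^ 2 :=
    pow_lt_pow_left₀ (by nlinarith) (by positivity) two_ne_zero
  nlinarith

/-- If all points near enough to `X` have unique nearest points, then the distance to `X` can be
increased at unit speed. -/
theorem exists_infDist_add_le [ProperSpace E] {X : Set E} (hX : IsClosed X) {p : E} {s : ℝ}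
    (hs : 0 ≤ s) (hpos : 0 < Metric.infDist p X)
    (hU : thick (Metric.infDist p X + s) X ⊆ Unp X) :
    ∃ w, dist w p ≤ s ∧ Metric.infDist p X + s ≤ Metric.infDist w X := by
  have hne : X.Nonempty := by
    by_contra h
    rw [Set.not_nonempty_iff_eq_empty] at h
    simp [h] at hpos
  -- Maximise the distance to `X` minus the penalty `c * dist w p`. A maximiser inside the ball
  -- would contradict the ascent rate, so it lies on the sphere of radius `s`.
  have step : ∀ c, 0 ≤ c → c < 1 →
      ∃ w ∈ Metric.closedBall p s, Metric.infDist p X + c * s ≤ Metric.infDist w X := by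
    intro c hc0 hc1
    obtain ⟨w, hw, hmax⟩ := (isCompact_closedBall p s).exists_isMaxOn
      (Metric.nonempty_closedBall.2 hs) (f := fun w => Metric.infDist w X - c * dist w p)
      (Continuous.continuousOn (by
        have := Metric.continuous_infDist_pt X
        fun_prop))
    have hwp : Metric.infDist p X ≤ Metric.infDist w X - c * dist w p := by
      simpa using hmax (Metric.mem_closedBall_self hs)
    rw [Metric.mem_closedBall] at hw
    refine ⟨w, hw, ?_⟩
    rcases hw.eq_or_lt with heq | hlt
    · rw [heq] at hwp
      linarith
    · exfalso
      have hwU : w ∈ Unp X := by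
        obtain ⟨x, hx, hd⟩ := hX.exists_infDist_eq_dist hne w
        refine hU ⟨x, hx, ?_⟩
        rw [dist_comm, ← hd]
        linarith [Metric.infDist_le_infDist_add_dist (s := X) (x := w) (y := p)]
      obtain ⟨w', hw', hasc⟩ := exists_infDist_ascent hX hwU
        (by have := mul_nonneg hc0 (dist_nonneg (x := w) (y := p)); linarith)
        hc0 hc1 (sub_pos.2 hlt)
      have htri := dist_triangle w' w p
      have h1 : Metric.infDist w' X - c * dist w' p ≤ Metric.infDist w X - c * dist w p :=
        hmax (by rw [Metric.mem_closedBall]; linarith)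
      have h2 := mul_le_mul_of_nonneg_left htri hc0
      linarith
  obtain ⟨w, hw, hmax⟩ := (isCompact_closedBall p s).exists_isMaxOn
    (Metric.nonempty_closedBall.2 hs) (f := fun w => Metric.infDist w X)
    (Metric.continuous_infDist_pt X).continuousOn
  refine ⟨w, hw, ?_⟩
  by_contra! hlt
  have hp : Metric.infDist p X ≤ Metric.infDist w X := hmax (Metric.mem_closedBall_self hs)
  have hs0 : 0 < s := by linarith
  -- This replaces the limit `c → 1`: if the maximum falls short by `e`, this choice of `c` loses
  -- only `e / 2`.
  set e := Metric.infDist p X + s - Metric.infDist w X with he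
  obtain ⟨v, hv, hle⟩ := step (1 - e / (2 * s))
    (by rw [sub_nonneg, div_le_one (by positivity)]; linarith)
    (by have : 0 < e / (2 * s) := div_pos (by linarith) (by positivity)
        linarith)
  have h1 : Metric.infDist v X ≤ Metric.infDist w X := hmax hv
  have h2 : (1 - e / (2 * s)) * s = s - e / 2 := by field_simp
  rw [h2] at hle
  linarith

/-- Federer's tangent ball property: a set with reach at least `β` has no points in the open
ball of radius `β` touching it at `x` and centred on the ray from `x` through a point `y` whose
nearest point is `x`. -/
theorem le_dist_tangent_center [ProperSpace E] {X : Set E} (hX : IsClosed X) {x y : E} {β : ℝ}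
    (hx : x ∈ X) (hnear : ∀ z ∈ X, dist x y ≤ dist z y) (hpos : 0 < dist x y)
    (hyβ : dist x y ≤ β) (hU : thick β X ⊆ Unp X) {z : E} (hz : z ∈ X) :
    β ≤ dist z (x + (β / dist x y) • (y - x)) := by
  have hD := infDist_eq_dist_of_forall_le hx hnear
  obtain ⟨w, hw, hle⟩ := exists_infDist_add_le hX (p := y) (s := β - dist x y) (by linarith)
    (by rwa [hD]) (by rw [hD]; convert hU using 2; ring)
  rw [hD] at hle
  set t := dist x y with ht
  have hu : ‖y - x‖ = t := by rw [ht, dist_comm, dist_eq_norm]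
  have hv : ‖w - y‖ ≤ β - t := by rwa [← dist_eq_norm]
  have huv : β ≤ ‖(y - x) + (w - y)‖ := by
    have h1 := Metric.infDist_le_dist_of_mem (x := w) hx
    rw [dist_eq_norm] at h1
    have h2 : (y - x) + (w - y) = w - x := by abel
    rw [h2]
    linarith
  have h3 := norm_add_le (y - x) (w - y)
  have hv' : ‖w - y‖ = β - t := by linarith
  -- Since `w` is at least `β` from `x` but at most `β - t` from `y`, the triangle inequality is an
  -- equality; hence `w` is the point at distance `β` on the ray, that is, the centre.
  have hray : SameRay ℝ (y - x) (w - y) := sameRay_iff_norm_add.2 (by linarith)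
  rw [sameRay_iff_norm_smul_eq, hu, hv'] at hray
  have hwc : x + (β / t) • (y - x) = w := by
    have h4 : w - y = t⁻¹ • (β - t) • (y - x) := by
      rw [← hray, smul_smul, inv_mul_cancel₀ hpos.ne', one_smul]
    have h5 : β / t = 1 + t⁻¹ * (β - t) := by
      field_simp
      ring
    rw [h5, add_smul, one_smul, mul_smul, ← h4]
    abel
  rw [hwc, dist_comm]
  refine le_trans ?_ (Metric.infDist_le_dist_of_mem hz)
  linarith

/-- Segments from points of `A^ε` to their nearest points in `X` stay inside `A^ε`. -/
theorem segment_subset_thick [ProperSpace E] {X A : Set E} (hX : IsClosed X) {α β δ ε : ℝ}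
    (hU : thick β X ⊆ Unp X) (hε : 0 ≤ ε) (hεβ : ε + δ ≤ β)
    (hrad : ε ^ 2 + (β - α) ^ 2 ≤ (β - δ) ^ 2)
    (hA : A ⊆ thick δ X) (hXA : thick α X ⊆ thick ε A) {x y : E} (hx : x ∈ X)
    (hy : y ∈ thick ε A) (hnear : ∀ z ∈ X, dist x y ≤ dist z y)
    (hyβ : dist x y ≤ β) {θ : ℝ} (hθ0 : 0 ≤ θ) (hθ1 : θ ≤ 1) :
    x + θ • (y - x) ∈ thick ε A := by
  set t := dist x y with ht
  have hu : ‖y - x‖ = t := by rw [ht, dist_comm, dist_eq_norm]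
  rcases le_or_gt (θ * t) α with hle | hgt
  · refine hXA ⟨x, hx, ?_⟩
    rw [dist_comm, dist_eq_norm, add_sub_cancel_left, norm_smul, hu, Real.norm_of_nonneg hθ0]
    exact hle
  rcases hθ1.eq_or_lt with rfl | hθ1
  · simpa using hy
  rcases (dist_nonneg : 0 ≤ dist x y).eq_or_lt with h0 | hpos
  · have hxy : x = y := dist_eq_zero.1 h0.symm
    rw [hxy, sub_self, smul_zero, add_zero]
    exact hy
  obtain ⟨a, ha, hay⟩ := hy
  obtain ⟨z, hz, hza⟩ := hA ha
  refine ⟨a, ha, ?_⟩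
  have hc := le_dist_tangent_center hX hx hnear hpos hyβ hU hz
  rw [← ht] at hc hpos
  have hac : β - δ ≤ dist a (x + (β / t) • (y - x)) := by
    have := dist_triangle z a (x + (β / t) • (y - x))
    linarith
  set q : ℝ := inner ℝ (a - x) (y - x) with hq
  have hexp : ∀ r : ℝ, dist a (x + r • (y - x)) ^ 2 = ‖a - x‖ ^ 2 - 2 * (r * q) + r ^ 2 * t ^ 2 := by
    intro r
    rw [dist_eq_norm, ← sub_sub, norm_sub_sq_real, inner_smul_right, norm_smul, hu, mul_pow,
      Real.norm_eq_abs, sq_abs]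
  have h1 : (β - δ) ^ 2 ≤ ‖a - x‖ ^ 2 - 2 * (β / t * q) + (β / t) ^ 2 * t ^ 2 := by
    rw [← hexp]
    exact pow_le_pow_left₀ (by linarith) hac 2
  have h2 : ‖a - x‖ ^ 2 - 2 * q + t ^ 2 ≤ ε ^ 2 := by
    have := hexp 1
    rw [one_smul, add_sub_cancel, one_mul, one_pow, one_mul] at this
    rw [← this]
    exact pow_le_pow_left₀ dist_nonneg hay 2
  refine (sq_le_sq₀ dist_nonneg hε).1 ?_
  rw [hexp]
  -- `Q` is the coordinate of `a - x` along the ray, and `s` the distance from `x` to the point in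
  -- question.
  obtain ⟨Q, hQ⟩ : ∃ Q, q = Q * t := ⟨q / t, by field_simp⟩
  obtain ⟨s, hs⟩ : ∃ s, s = θ * t := ⟨_, rfl⟩
  have hst : s < t := by rw [hs]; nlinarith
  rw [← hs] at hgt
  rw [hQ] at h2 ⊢
  have e1 : β / t * q = β * Q := by rw [hQ]; field_simp
  have e2 : (β / t) ^ 2 * t ^ 2 = β ^ 2 := by field_simp
  rw [e1, e2] at h1
  have e3 : θ * (Q * t) = s * Q := by rw [hs]; ring
  have e4 : θ ^ 2 * t ^ 2 = s ^ 2 := by rw [hs]; ring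
  rw [e3, e4]
  set N := ‖a - x‖ ^ 2
  -- Subtracting `(r - s)²` from `N - 2rQ + r² - ε²` leaves an affine function of `r`. It is
  -- nonnegative at `β` and negative at `t`; were the claim false, it would be positive at `s`,
  -- which is impossible for `s < t < β`.
  have hsα : (β - s) ^ 2 ≤ (β - α) ^ 2 := pow_le_pow_left₀ (by linarith) (by linarith) 2
  have hlβ : 0 ≤ N - 2 * (β * Q) + β ^ 2 - ε ^ 2 - (β - s) ^ 2 := by linarith
  have hlt : N - 2 * (Q * t) + t ^ 2 - ε ^ 2 - (t - s) ^ 2 < 0 := by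
    have : 0 < (t - s) ^ 2 := pow_pos (by linarith) 2
    linarith
  have htβ : t < β := by
    refine lt_of_le_of_ne hyβ fun h => ?_
    rw [← h] at hlβ
    linarith
  by_contra! hcon
  have p1 := mul_pos (sub_pos.2 hcon) (sub_pos.2 htβ)
  have p2 := mul_nonneg hlβ (sub_pos.2 hst).le
  have p3 := mul_pos (neg_pos.2 hlt) (sub_pos.2 (hst.trans htβ))
  nlinarith

end InnerProduct

/-! ### Formal properties of interleavings. -/

section Functors

variable {A : Type v} [Category.{w} A]

theorem Interleaved.of_iso {δ : ℝ≥0} {C C' D D' : Interval ⥤ A} (e : C ≅ C') (e' : D ≅ D')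
    (h : Interleaved δ C D) : Interleaved δ C' D' := by
  obtain ⟨Φ, Ψ, h⟩ := h
  refine ⟨e.inv ≫ Φ ≫ Functor.whiskerLeft (widen δ) e'.hom,
    e'.inv ≫ Ψ ≫ Functor.whiskerLeft (widen δ) e.hom, fun I => ⟨?_, ?_⟩⟩
  · have := (h I).1
    simp [reassoc_of% this]
  · have := (h I).2
    simp [reassoc_of% this]

theorem functorDist_le {δ : ℝ≥0} {C D : Interval ⥤ A} (h : Interleaved δ C D) :
    functorDist C D ≤ δ :=
  iInf₂_le δ h

end Functors

/-! ### Reeb graphs and their precosheaves. -/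

section Reeb

variable {X : Type u} [TopologicalSpace X] (f : C(X, ℝ))

/-- The quotient map from `f⁻¹(I)` to the preimage of `I` in the Reeb graph. -/
def rbProj (I : Set ℝ) : C(f ⁻¹' I, rbMap f ⁻¹' I) where
  toFun x := ⟨Quotient.mk (reebSetoid f) x.1, x.2⟩
  continuous_toFun := (continuous_quotient_mk'.comp continuous_subtype_val).subtype_mk _

/-- Openness of `I` matters here: a quotient map stays one when restricted to the preimage of an
open set. -/
theorem isQuotientMap_rbProj {I : Set ℝ} (hI : IsOpen I) :
    Topology.IsQuotientMap (rbProj f I) :=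
  Topology.IsQuotientMap.restrictPreimage_isOpen (f := (Quotient.mk (reebSetoid f) : X → Rb f))
    isQuotientMap_quotient_mk' (hI.preimage (rbMap f).continuous)

theorem isConnected_rbProj_fiber (I : Set ℝ) (y : rbMap f ⁻¹' I) :
    IsConnected (rbProj f I ⁻¹' {y}) := by
  obtain ⟨y, hy⟩ := y
  obtain ⟨x, rfl⟩ := Quotient.exists_rep y
  refine ⟨⟨⟨x, hy⟩, rfl⟩, ?_⟩
  rw [← Topology.IsInducing.subtypeVal.isPreconnected_image]
  convert isPreconnected_connectedComponentIn (x := x) (F := f ⁻¹' {f x}) using 1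
  ext z
  constructor
  · rintro ⟨z, hz, rfl⟩
    have : Quotient.mk (reebSetoid f) z.1 = Quotient.mk (reebSetoid f) x :=
      congrArg Subtype.val hz
    exact Quotient.exact this.symm
  · intro hz
    have hzx : f z = f x := connectedComponentIn_subset (f ⁻¹' {f x}) x hz
    refine ⟨⟨z, ?_⟩, Subtype.ext (Quotient.sound hz).symm, rfl⟩
    rw [Set.mem_preimage, hzx]
    exact hy

/-- Under a quotient map with connected fibres, the preimage of a component is a component. -/
theorem bijective_connectedComponentsMap_rbProj {I : Set ℝ} (hI : IsOpen I) :
    Function.Bijective (rbProj f I).continuous.connectedComponentsMap := by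
  have hq := isQuotientMap_rbProj f hI
  constructor
  · intro x y h
    obtain ⟨x, rfl⟩ := ConnectedComponents.surjective_coe x
    obtain ⟨y, rfl⟩ := ConnectedComponents.surjective_coe y
    have h' : ((rbProj f I x : rbMap f ⁻¹' I) : ConnectedComponents (rbMap f ⁻¹' I)) =
      (rbProj f I y : rbMap f ⁻¹' I) := h
    rw [ConnectedComponents.coe_eq_coe] at h' ⊢
    rw [← hq.isCoinducing.preimage_connectedComponent (isConnected_rbProj_fiber f I),
      ← hq.isCoinducing.preimage_connectedComponent (isConnected_rbProj_fiber f I), h']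
  · intro y
    obtain ⟨y, rfl⟩ := ConnectedComponents.surjective_coe y
    obtain ⟨x, rfl⟩ := hq.surjective y
    exact ⟨x, rfl⟩

/-- Passing to the Reeb graph does not change the Reeb precosheaf. -/
noncomputable def precosheafRbIso : precosheaf f ≅ precosheaf (rbMap f) :=
  NatIso.ofComponents
    (fun I => (Equiv.ofBijective _ (bijective_connectedComponentsMap_rbProj f I.2.1)).toIso)
    (by
      intro I J i
      ext x
      obtain ⟨x, rfl⟩ := ConnectedComponents.surjective_coe x
      rfl)

end Reeb

/-! ### Interleaving by the nearest-point projection. -/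

/-- A map moving points along paths on which the function changes little induces an
interleaving. -/
theorem interleaved_of_retraction {X Y : Type u} [TopologicalSpace X] [TopologicalSpace Y]
    (f : C(X, ℝ)) (g : C(Y, ℝ)) (η : ℝ≥0) (i : C(X, Y)) (π : C(Y, X))
    (hi : ∀ x, g (i x) = f x) (hπi : ∀ x, π (i x) = x)
    (H : Y → C(unitInterval, Y)) (hH0 : ∀ y, H y 0 = i (π y)) (hH1 : ∀ y, H y 1 = y)
    (hH : ∀ y t, dist (g y) (g (H y t)) ≤ η) :
    Interleaved η (precosheaf g) (precosheaf f) := by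
  have hgπ : ∀ y, dist (g y) (f (π y)) ≤ η := by
    intro y
    have := hH y 0
    rwa [hH0, hi] at this
  refine ⟨{ app := fun I => C₀.map (TopCat.ofHom ⟨fun y : g ⁻¹' I.1 =>
              (⟨π y.1, ⟨g y.1, y.2, hgπ y.1⟩⟩ : f ⁻¹' (thick η I.1)), by fun_prop⟩)
            naturality := ?_ },
          { app := fun I => C₀.map (TopCat.ofHom ⟨fun x : f ⁻¹' I.1 =>
              (⟨i x.1, ⟨f x.1, x.2, by rw [hi, dist_self]; exact η.2⟩⟩ : g ⁻¹' (thick η I.1)),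
                by fun_prop⟩)
            naturality := ?_ }, fun I => ⟨?_, ?_⟩⟩
  · intro I J j
    ext x
    obtain ⟨x, rfl⟩ := ConnectedComponents.surjective_coe x
    rfl
  · intro I J j
    ext x
    obtain ⟨x, rfl⟩ := ConnectedComponents.surjective_coe x
    rfl
  · ext y
    obtain ⟨y, rfl⟩ := ConnectedComponents.surjective_coe y
    -- Only components matter, so a single path from `i (π y)` to `y` suffices; `H` need not be
    -- continuous in `y`.
    let γ : unitInterval → g ⁻¹' (thick η (thick η I.1)) := fun t =>
      ⟨H y.1 t, subset_thick η.2 _ ⟨g y.1, y.2, hH y.1 t⟩⟩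
    have hγ : Continuous γ := by fun_prop
    have h0 : γ 0 = ⟨i (π y.1), hH0 y.1 ▸ (γ 0).2⟩ := Subtype.ext (hH0 y.1)
    have h1 : γ 1 = ⟨y.1, le_widen_widen η I y.2⟩ := Subtype.ext (hH1 y.1)
    have hc : ((γ 0 : _) : ConnectedComponents (g ⁻¹' (thick η (thick η I.1)))) = γ 1 :=
      ConnectedComponents.coe_eq_coe'.2
        ((isPreconnected_range hγ).subset_connectedComponent ⟨1, rfl⟩ ⟨0, rfl⟩)
    rw [h0, h1] at hc
    exact hc
  · ext x
    obtain ⟨x, rfl⟩ := ConnectedComponents.surjective_coe x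
    exact congrArg (ConnectedComponents.mk (α := f ⁻¹' (thick η (thick η I.1))))
      (Subtype.ext (hπi x.1) : (⟨π (i x.1), _⟩ : f ⁻¹' (thick η (thick η I.1))) =
        ⟨x.1, le_widen_widen η I x.2⟩)

/-- Continuity is `exists_dist_nearest_lt`: the projection of a nearby `y'` is at least as close to
`y'` as `π y` is. -/
theorem exists_nearest_projection {M : Type*} [MetricSpace M] [ProperSpace M] {X : Set M}
    (hX : IsClosed X) {Y : Set M} (hY : Y ⊆ Unp X) :
    ∃ π : C(Y, X), ∀ y : Y, ∀ z ∈ X \ {(π y : M)}, dist (π y : M) y < dist z y := by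
  choose π hπ hu using fun y : Y => hY y.2
  refine ⟨⟨fun y => ⟨π y, hπ y⟩, ?_⟩, hu⟩
  rw [Metric.continuous_iff]
  intro y η hη
  obtain ⟨ρ, hρ, h⟩ := exists_dist_nearest_lt hX (hπ y) (hu y) hη
  refine ⟨ρ, hρ, fun y' hy' => h y' hy' _ (hπ y') ?_⟩
  by_cases he : π y = π y'
  · rw [he]
  · exact (hu y' _ ⟨hπ y, he⟩).le

end ReebApprox

theorem mainTheorem5 (d : ℕ) (X A : Set (EuclideanSpace ℝ (Fin d)))
    (hX : IsClosed X) (hreach : 0 < reach X)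
    (α β δ ε : ℝ) (k : ℝ≥0)
    (hδ : 0 ≤ δ) (hδβ : δ < β) (hβ : ENNReal.ofReal β < reach X)
    (hα : 0 < α) (hk : 0 < k) (hε : 0 ≤ ε)
    (hrad : 0 ≤ (β - δ) ^ 2 - (β - α) ^ 2)
    (hεle : ε ≤ √((β - δ) ^ 2 - (β - α) ^ 2))
    (hA : A ⊆ thick δ X) (hXA : thick α X ⊆ thick ε A)
    (g : thick ε A → ℝ) (hg : LipschitzWith k g) :
    dI (rbMap (⟨g, hg.continuous⟩ : C(thick ε A, ℝ)))
        (rbMap (restrictTo ((subset_thick hα.le X).trans hXA)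
          (⟨g, hg.continuous⟩ : C(thick ε A, ℝ)))) ≤
      ENNReal.ofReal (k * (ε + δ)) := by
  have hsq : ε ^ 2 ≤ (β - δ) ^ 2 - (β - α) ^ 2 := by
    rw [← Real.sq_sqrt hrad]
    exact pow_le_pow_left₀ hε hεle 2
  have hεβ : ε + δ ≤ β := by
    have : ε ≤ β - δ := (sq_le_sq₀ hε (by linarith)).1 (by nlinarith [sq_nonneg (β - α)])
    linarith
  obtain ⟨r, hr, hU⟩ := exists_thick_subset_Unp hβ
  have hU : thick β X ⊆ Unp X := (thick_mono hr).trans hU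
  have hYX : ∀ y ∈ thick ε A, ∃ x ∈ X, dist x y ≤ ε + δ := by
    rintro y ⟨a, ha, hay⟩
    obtain ⟨x, hx, hxa⟩ := hA ha
    exact ⟨x, hx, by linarith [dist_triangle x a y]⟩
  have hYU : thick ε A ⊆ Unp X := fun y hy => by
    obtain ⟨x, hx, h⟩ := hYX y hy
    exact hU ⟨x, hx, h.trans hεβ⟩
  obtain ⟨π, hπ⟩ := exists_nearest_projection hX hYU
  have hnear : ∀ y : thick ε A, ∀ z ∈ X, dist (π y : EuclideanSpace ℝ (Fin d)) y ≤ dist z y := by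
    intro y z hz
    by_cases h : z = π y
    · rw [h]
    · exact (hπ y z ⟨hz, h⟩).le
  have hdist : ∀ y : thick ε A, dist (π y : EuclideanSpace ℝ (Fin d)) y ≤ ε + δ := by
    intro y
    obtain ⟨x, hx, h⟩ := hYX y y.2
    exact (hnear y x hx).trans h
  have hXY := (subset_thick hα.le X).trans hXA
  have hη : 0 ≤ (k : ℝ) * (ε + δ) := by positivity
  refine functorDist_le (δ := (k * (ε + δ)).toNNReal)
    (Interleaved.of_iso (precosheafRbIso _) (precosheafRbIso _)
    (interleaved_of_retraction _ _ _ ⟨Set.inclusion hXY, continuous_inclusion hXY⟩ π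
      (fun _ => rfl) ?_
      (fun y => ⟨fun t => ⟨(π y : EuclideanSpace ℝ (Fin d)) + (t : ℝ) • ((y : _) - π y),
        segment_subset_thick hX hU hε hεβ (by linarith) hA hXA (π y).2 y.2 (hnear y)
          ((hdist y).trans hεβ) t.2.1 t.2.2⟩, by fun_prop⟩) ?_ ?_ ?_))
  · intro x
    -- A nearest point other than `x` itself would be at negative distance from `x`.
    by_contra h
    have := hπ ⟨x, hXY x.2⟩ x ⟨x.2, fun he => h (Subtype.ext he.symm)⟩
    rw [dist_self] at this
    exact absurd this dist_nonneg.not_gt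
  · intro y
    exact Subtype.ext (by simp)
  · intro y
    exact Subtype.ext (by simp)
  · intro y t
    rw [Real.coe_toNNReal _ hη]
    refine (hg.dist_le_mul _ _).trans (mul_le_mul_of_nonneg_left ?_ k.2)
    rw [Subtype.dist_eq, dist_comm]
    refine le_trans ?_ (hdist y)
    have h1 : (π y : EuclideanSpace ℝ (Fin d)) + (t : ℝ) • ((y : EuclideanSpace ℝ (Fin d)) - π y) - y
        = (1 - (t : ℝ)) • ((π y : EuclideanSpace ℝ (Fin d)) - y) := by module
    change dist ((π y : EuclideanSpace ℝ (Fin d)) + (t : ℝ) • ((y : EuclideanSpace ℝ (Fin d)) - π y))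
      y ≤ _
    rw [dist_eq_norm, h1, norm_smul, dist_eq_norm, Real.norm_of_nonneg (by linarith [t.2.2])]
    exact mul_le_of_le_one_left (norm_nonneg _) (by linarith [t.2.1])
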